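/- Let $n\ge\ell\ge 2$ and $q\ge 1$ be integers and let $\mathbf{t}=(t_1,\dots,t_q)$ be a vector of positive integers, with $\|\mathbf{t}\|_\infty=\max_j t_j$. For a finite graph $G$, write $m_\ell(G)$ for the number of unlabelled copies of $K_\ell$ in $G$, and write $G\not\to\mathbf{t}K_2$ if the edges of $G$ can be coloured with $q$ colours $1,\dots,q$ (one colour per edge) so that, for every $j$, the edges of colour $j$ contain no matching of size $t_j$. Let $$\mathbf{GRT}_\ell(n\to\mathbf{t}K_2)=\max\{m_\ell(G) : |V(G)|=n,\ G\not\to\mathbf{t}K_2\}.$$ For integers $x,y\ge 0$ with $x+y\le n$, let $G_{n,x,y}$ be the clique-cone graph, i.e. the $n$-vertex graph that is the join of $K_y$ with the disjoint union of $K_x$ and $n-x-y$ isolated vertices. Then there exist integers $x,y$ with $1\le x\le 2\|\mathbf{t}\|_\infty-1$ and $0\le y\le n-x$ such that $G_{n,x,y}\not\to\mathbf{t}K_2$ and $m_\ell(G_{n,x,y})=\mathbf{GRT}_\ell(n\to\mathbf{t}K_2)$. -/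

import Mathlib

/-- `G → (H₁, …, H_q)`: every `q`-edge-colouring of `G` has, for some colour `j`,
a (not necessarily induced) copy of `H j` all of whose edges have colour `j`. -/
def Arrows {V : Type} (G : SimpleGraph V) {q : ℕ} {W : Fin q → Type}
    (H : ∀ j, SimpleGraph (W j)) : Prop :=
  ∀ C : G.EdgeLabeling (Fin q), ∃ j, (H j).IsContained (C.labelGraph j)

/-- `t K₂`, the matching of size `t`: the edges are the pairs `(i, 0)(i, 1)` for `i < t`. -/
def matchingGraph (t : ℕ) : SimpleGraph (Fin t × Fin 2) where
  Adj a b := a.1 = b.1 ∧ a.2 ≠ b.2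
  symm := ⟨fun _ _ h => ⟨h.1.symm, h.2.symm⟩⟩
  loopless := ⟨fun _ h => h.2 rfl⟩

/-- `t K₂ = (t₁ K₂, …, t_q K₂)` for a vector `t = (t₁, …, t_q)`. -/
def matchingGraphs {q : ℕ} (t : Fin q → ℕ) : ∀ j, SimpleGraph (Fin (t j) × Fin 2) :=
  fun j => matchingGraph (t j)

/-- `m_ℓ(G)`: the number of unlabelled copies of `K_ℓ` in `G`. -/
noncomputable def cliqueCount {V : Type} [Fintype V] (ℓ : ℕ) (G : SimpleGraph V) : ℕ :=
  G.copyCount (⊤ : SimpleGraph (Fin ℓ))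

open Classical in
/-- The generalised Ramsey–Turán number `GRT_T(n → (H₁, …, H_q))`: the maximum number of unlabelled
copies of `T` in an `n`-vertex graph `G` with `G ↛ (H₁, …, H_q)` (and `0` if there is no such
graph). -/
noncomputable def grt {U : Type} (T : SimpleGraph U) (n : ℕ) {q : ℕ} {W : Fin q → Type}
    (H : ∀ j, SimpleGraph (W j)) : ℕ :=
  (Finset.univ.filter fun G : SimpleGraph (Fin n) => ¬ Arrows G H).sup fun G => G.copyCount T

/-- The clique-cone graph `G_{n,x,y}` (for `x + y ≤ n`), on the vertex set `{0, …, n - 1}`, with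
clique set `X = {0, …, x - 1}` and cone set `Y = {x, …, x + y - 1}`: distinct vertices are adjacent
iff both are in `X` or at least one of them is in `Y`. -/
def cliqueCone (n x y : ℕ) : SimpleGraph (Fin n) where
  Adj u v := u ≠ v ∧
    ((u.val < x ∧ v.val < x) ∨ (x ≤ u.val ∧ u.val < x + y) ∨ (x ≤ v.val ∧ v.val < x + y))
  symm := ⟨fun _ _ h => ⟨h.1.symm, by
    rcases h.2 with h | h | h
    · exact Or.inl h.symm
    · exact Or.inr (Or.inr h)
    · exact Or.inr (Or.inl h)⟩⟩
  loopless := ⟨fun _ h => h.1 rfl⟩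

/-! An extremal graph `G` is compared with one clique-cone. In a good colouring, colour `j` has no
matching of size `t j`, so a vertex set `A j` with at most `t j - 1` elements leaves few edges of
that colour: at most `d j * (2 * d j + 1)`, as in a clique on `2 * d j + 1` vertices, where `d j = t
j - 1 - #(A j)` (`exists_card_adj_avoiding_le`, a weak, edge-counting form of Tutte–Berge).

Let `Y` be the union of the `A j`, `s` the largest `d j`, `D` the sum of the `d j` and `S` that of
the `t j - 1`. Take `x = 2 * s + 1` and `y = S - s`, if these fit into `n` vertices. Since `#Y ≤ S -
D`, declaring only `#Y` cone vertices special leaves a clique on at least `s + D + 1` others, which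
has at least as many edges as `G` has outside `Y`. By Kruskal–Katona it then has at least as many
`r`-cliques for all `r ≥ 2`. Sorting the `ℓ`-cliques by their trace on the special set gives the
inequality (`card_cliqueFinset_le_sum`, `sum_le_card_cliqueFinset`).

The cone itself is well coloured by giving the clique one colour and sharing out the cone vertices
(`not_arrows_cliqueCone`). -/

/-! ### Kruskal–Katona at binomial coefficients. -/

namespace Finset

open Finset.Colex FinsetFamily

lemma card_Iio_fin {n : ℕ} (a : Fin n) : #(Iio a) = (a : ℕ) := by simp

/-- In colex order the sets below `a` come before every set that contains `a`, and `insert a (Iio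
b)` is the first set of its size with maximum `a`. -/
lemma isInitSeg_insert_powersetCard_Iio {n r : ℕ} {a b : Fin n} (hb : (b : ℕ) = r) (hba : b ≤ a) :
    IsInitSeg (insert (insert a (Iio b)) (powersetCard (r + 1) (Iio a))) (r + 1) := by
  have hs : #(insert a (Iio b)) = r + 1 := by
    rw [card_insert_of_notMem (by simpa using hba), card_Iio_fin, hb]
  refine ⟨fun u hu => ?_, fun u v hu ⟨hvu, hv⟩ => ?_⟩
  · rcases mem_insert.1 hu with rfl | hu
    · exact hs
    · exact (mem_powersetCard.1 hu).2
  refine mem_insert_of_mem (mem_powersetCard.2 ⟨fun x hx => ?_, hv⟩)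
  rcases mem_insert.1 hu with rfl | hu
  · have hle : x ≤ a := forall_le_mono hvu.le (fun y hy => by
      rcases mem_insert.1 hy with rfl | hy
      · exact le_rfl
      · exact ((mem_Iio.1 hy).trans_le hba).le) x hx
    refine mem_Iio.2 (lt_of_le_of_ne hle ?_)
    -- If `v` also had this maximum, the comparison would be decided at some `c < b`; then `v` would
    -- lie inside the inserted set and equal it.
    rintro rfl
    obtain ⟨c, hc, hcv, h⟩ := toColex_lt_toColex_iff_exists_forall_lt.1 hvu
    have hcb : c < b := by
      rcases mem_insert.1 hc with rfl | hc
      · exact absurd hx hcv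
      · exact mem_Iio.1 hc
    have hsub : v ⊆ insert x (Iio b) := fun y hy => by
      by_contra hys
      exact hys (mem_insert_of_mem (mem_Iio.2 ((h y hy hys).trans hcb)))
    have := eq_of_subset_of_card_le hsub (by rw [hs, hv])
    exact hcv (this ▸ hc)
  · exact mem_Iio.2 (forall_lt_mono hvu.le
      (fun y hy => mem_Iio.1 ((mem_powersetCard.1 hu).1 hy)) x hx)

/-- A strict form of the Kruskal–Katona theorem at binomial coefficients. -/
theorem choose_lt_card_shadow {n m r : ℕ} {𝒜 : Finset (Finset (Fin n))} (hr : 1 ≤ r)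
    (h𝒜 : (𝒜 : Set (Finset (Fin n))).Sized (r + 1)) (hm : m.choose (r + 1) < #𝒜) :
    m.choose r < #(∂ 𝒜) := by
  rcases lt_or_ge m r with hmr | hmr
  · rw [Nat.choose_eq_zero_of_lt hmr, card_pos]
    obtain ⟨s, hs⟩ := card_pos.1 (Nat.zero_lt_of_lt hm)
    obtain ⟨a, ha⟩ := card_pos.1 (by rw [h𝒜 hs]; omega : 0 < #s)
    exact ⟨_, erase_mem_shadow hs ha⟩
  have hmn : m < n := by
    by_contra! h
    have h1 : #𝒜 ≤ n.choose (r + 1) := by simpa using h𝒜.card_le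
    exact absurd (h1.trans (Nat.choose_le_choose _ h)) (not_le.2 hm)
  set a : Fin n := ⟨m, hmn⟩
  set b : Fin n := ⟨r, hmr.trans_lt hmn⟩
  have hba : b ≤ a := hmr
  set s := insert a (Iio b) with hs
  have has : s ∉ powersetCard (r + 1) (Iio a) := fun h => by
    simpa using (mem_powersetCard.1 h).1 (mem_insert_self a _)
  have hC := isInitSeg_insert_powersetCard_Iio (r := r) (a := a) (b := b) rfl hba
  have hcard : #(insert s (powersetCard (r + 1) (Iio a))) ≤ #𝒜 := by
    rw [card_insert_of_notMem has, card_powersetCard, card_Iio_fin]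
    exact hm
  refine lt_of_lt_of_le ?_ (kruskal_katona h𝒜 hcard hC)
  -- Removing `r - 1` from `s` keeps `a`, which gives a shadow member beyond the `r`-subsets of `Iio
  -- a`: the source of strictness.
  set z : Fin n := ⟨r - 1, by omega⟩
  have hzb : z < b := Fin.lt_def.2 (by simp only [z, b]; omega)
  have hz : z ∈ s := mem_insert_of_mem (mem_Iio.2 hzb)
  have hza : z ≠ a := (hzb.trans_le hba).ne
  have hnot : s.erase z ∉ powersetCard r (Iio a) := fun h => by
    simpa using (mem_powersetCard.1 h).1 (mem_erase.2 ⟨hza.symm, mem_insert_self a _⟩)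
  have hsub : insert (s.erase z) (powersetCard r (Iio a)) ⊆
      ∂ (insert s (powersetCard (r + 1) (Iio a))) := by
    intro u hu
    rcases mem_insert.1 hu with rfl | hu
    · exact erase_mem_shadow (mem_insert_self _ _) hz
    obtain ⟨hua, hur⟩ := mem_powersetCard.1 hu
    -- An `r`-subset of `Iio a` extends inside `Iio a` unless it is all of it; then `m = r` and it
    -- is `s` without `a`.
    by_cases hex : Iio a ⊆ u
    · have hu' : u = Iio a := hua.antisymm hex
      have hmr' : m = r := by rw [← hur, hu', card_Iio_fin]
      have : u = s.erase a := by
        have hab : a = b := Fin.ext hmr'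
        rw [hu', hs, hab, erase_insert (by simp)]
      exact this ▸ erase_mem_shadow (mem_insert_self _ _) (mem_insert_self _ _)
    · obtain ⟨y, hy, hyu⟩ := not_subset.1 hex
      refine mem_shadow_iff_insert_mem.2 ⟨y, hyu, mem_insert_of_mem (mem_powersetCard.2 ⟨?_, ?_⟩)⟩
      · exact insert_subset hy hua
      · rw [card_insert_of_notMem hyu, hur]
  have := card_le_card hsub
  rw [card_insert_of_notMem hnot, card_powersetCard, card_Iio_fin] at this
  exact this

end Finset

/-! ### Clique numbers from edge numbers; copies of complete graphs as cliques. -/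

namespace SimpleGraph

open Finset FinsetFamily

/-- The shadow of the `(r + 1)`-cliques consists of `r`-cliques, so an excess at size `r + 1` would
force an excess at size `r`. -/
theorem card_cliqueFinset_le_choose {n m r : ℕ} (G : SimpleGraph (Fin n)) [DecidableRel G.Adj]
    (h : #(G.cliqueFinset 2) ≤ m.choose 2) (hr : 2 ≤ r) :
    #(G.cliqueFinset r) ≤ m.choose r := by
  induction r, hr using Nat.le_induction with
  | base => exact h
  | succ r hr ih =>
    by_contra! hlt
    have hsub : ∂ (G.cliqueFinset (r + 1)) ⊆ G.cliqueFinset r := fun s hs => by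
      obtain ⟨a, ha, h⟩ := mem_shadow_iff_insert_mem.1 hs
      have h := (mem_cliqueFinset_iff.1 h).erase_of_mem (mem_insert_self a s)
      rw [erase_insert ha] at h
      exact mem_cliqueFinset_iff.2 h
    have := choose_lt_card_shadow (by omega)
      (fun s hs => (mem_cliqueFinset_iff.1 (mem_coe.1 hs)).2) hlt
    exact absurd (ih.trans_lt this) (not_lt.2 (card_le_card hsub))

theorem two_mul_card_cliqueFinset_two_le {V : Type*} [Fintype V] [DecidableEq V]
    (G : SimpleGraph V) [DecidableRel G.Adj] :
    2 * #(G.cliqueFinset 2) ≤ #{p : V × V | G.Adj p.1 p.2} := by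
  rw [card_eq_sum_card_fiberwise (f := fun p : V × V => ({p.1, p.2} : Finset V))
    (t := G.cliqueFinset 2), mul_comm, ← smul_eq_mul]
  · refine card_nsmul_le_sum _ _ _ fun s hs => ?_
    obtain ⟨hs, hs2⟩ := mem_cliqueFinset_iff.1 hs
    obtain ⟨u, v, huv, rfl⟩ := card_eq_two.1 hs2
    have hadj : G.Adj u v := hs (by simp) (by simp) huv
    refine Nat.succ_le_of_lt (one_lt_card.2 ⟨(u, v), ?_, (v, u), ?_, ?_⟩)
    · simpa using hadj
    · simpa [pair_comm] using hadj.symm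
    · exact fun h => huv (congrArg Prod.fst h)
  · rintro ⟨u, v⟩ hp
    have hadj : G.Adj u v := by simpa using hp
    refine mem_coe.2 (mem_cliqueFinset_iff.2 ⟨?_, card_pair hadj.ne⟩)
    simp [isClique_iff, Set.pairwise_insert, hadj, hadj.symm]

theorem copyCount_completeGraph {V : Type*} [Fintype V] [DecidableEq V] (G : SimpleGraph V)
    [DecidableRel G.Adj] {ℓ : ℕ} :
    G.copyCount (⊤ : SimpleGraph (Fin ℓ)) = #(G.cliqueFinset ℓ) := by
  classical
  rw [copyCount]
  refine card_bij (fun G' _ => G'.verts.toFinset) ?_ ?_ ?_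
  · intro G' hG'
    obtain ⟨e⟩ := (mem_filter.1 hG').2
    refine mem_cliqueFinset_iff.2 ⟨fun u hu v hv huv => ?_, ?_⟩
    · simp only [Set.coe_toFinset] at hu hv
      have : G'.coe.Adj ⟨u, hu⟩ ⟨v, hv⟩ := by
        rw [← e.symm.map_adj_iff, top_adj]
        exact fun h => huv (congrArg Subtype.val (e.symm.injective h))
      exact G'.coe_adj_sub _ _ this
    · rw [Set.toFinset_card, ← Fintype.card_congr e.toEquiv, Fintype.card_fin]
  · intro G₁ h₁ G₂ h₂ h
    have adj : ∀ G' : G.Subgraph, Nonempty ((⊤ : SimpleGraph (Fin ℓ)) ≃g G'.coe) → ∀ u v,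
        G'.Adj u v ↔ u ∈ G'.verts ∧ v ∈ G'.verts ∧ u ≠ v := by
      rintro G' ⟨e⟩ u v
      refine ⟨fun h => ⟨G'.edge_vert h, G'.edge_vert h.symm, h.ne⟩, fun ⟨hu, hv, huv⟩ => ?_⟩
      have : G'.coe.Adj ⟨u, hu⟩ ⟨v, hv⟩ := by
        rw [← e.symm.map_adj_iff, top_adj]
        exact fun h => huv (congrArg Subtype.val (e.symm.injective h))
      exact this
    have hv : G₁.verts = G₂.verts := Set.toFinset_inj.1 h
    refine Subgraph.ext hv ?_
    ext u v
    rw [adj G₁ (mem_filter.1 h₁).2, adj G₂ (mem_filter.1 h₂).2, hv]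
  · intro s hs
    rw [mem_cliqueFinset_iff] at hs
    obtain ⟨G', hG', he⟩ : ∃ G' : G.Subgraph, G'.verts = (s : Set V) ∧
        Nonempty ((⊤ : SimpleGraph (Fin ℓ)) ≃g G'.coe) := by
      refine ⟨(⊤ : G.Subgraph).induce (s : Set V), rfl, ?_⟩
      obtain ⟨e⟩ : Nonempty (Fin ℓ ≃ ((⊤ : G.Subgraph).induce (s : Set V)).verts) := by
        refine ⟨(Fintype.equivFinOfCardEq ?_).symm⟩
        rw [← hs.2, ← Fintype.card_coe]
        exact Fintype.card_congr (Equiv.refl _)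
      refine ⟨⟨e, fun {i j} => ?_⟩⟩
      rw [top_adj, Subgraph.coe_adj]
      refine ⟨fun h hij => h.ne (by rw [hij]), fun h => ?_⟩
      have hne : (e i : V) ≠ e j := fun h' => h (e.injective (Subtype.ext h'))
      rw [Subgraph.induce_adj]
      exact ⟨(e i).2, (e j).2, hs.1 (e i).2 (e j).2 hne⟩
    refine ⟨G', ?_, ?_⟩
    · rw [mem_filter]
      exact ⟨by simp, he⟩
    · ext v
      rw [Set.mem_toFinset, hG', mem_coe]

end SimpleGraph

/-! ### Matchings, augmenting paths and the edge bound. -/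

namespace SimpleGraph

open Finset

/-- The pairs `a i`, `b i` form a matching of `G` indexed by `ι`. -/
structure IsMatchingPair {V ι : Type*} (G : SimpleGraph V) (a b : ι → V) : Prop where
  left_injective : Function.Injective a
  right_injective : Function.Injective b
  ne : ∀ i j, a i ≠ b j
  adj : ∀ i, G.Adj (a i) (b i)

/-- `G` has a matching with `t` edges. -/
def HasMatching {V : Type*} (G : SimpleGraph V) (t : ℕ) : Prop :=
  ∃ a b : Fin t → V, G.IsMatchingPair a b

theorem matchingGraph_isContained_iff {V : Type*} {G : SimpleGraph V} {t : ℕ} :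
    (matchingGraph t).IsContained G ↔ G.HasMatching t := by
  constructor
  · rintro ⟨f⟩
    refine ⟨fun i => f (i, 0), fun i => f (i, 1), ?_, ?_, ?_, ?_⟩
    · intro i j h
      exact congrArg Prod.fst (f.injective h)
    · intro i j h
      exact congrArg Prod.fst (f.injective h)
    · intro i j h
      exact absurd (congrArg Prod.snd (f.injective h)) (by simp)
    · exact fun i => f.toHom.map_adj ⟨rfl, by simp⟩
  · rintro ⟨a, b, h⟩
    refine ⟨⟨⟨fun p => if p.2 = 0 then a p.1 else b p.1, ?_⟩, ?_⟩⟩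
    · rintro ⟨i, x⟩ ⟨j, y⟩ ⟨hij, hxy⟩
      obtain rfl : i = j := hij
      fin_cases x <;> fin_cases y <;> simp_all [h.adj, (h.adj _).symm]
    · rintro ⟨i, x⟩ ⟨j, y⟩ hxy
      have h1 := h.ne i j
      have h2 := h.ne j i
      fin_cases x <;> fin_cases y <;>
        simp_all [h.left_injective.eq_iff, h.right_injective.eq_iff, eq_comm]

namespace IsMatchingPair

variable {V ι : Type*} {G : SimpleGraph V} {a b : ι → V}

theorem hasMatching [Fintype ι] (h : G.IsMatchingPair a b) : G.HasMatching (Fintype.card ι) := by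
  let e := (Fintype.equivFin ι).symm
  exact ⟨a ∘ e, b ∘ e, h.left_injective.comp e.injective, h.right_injective.comp e.injective,
    fun i j => h.ne _ _, fun i => h.adj _⟩

theorem swap (h : G.IsMatchingPair a b) (p : ι → Prop) [DecidablePred p] :
    G.IsMatchingPair (fun i => if p i then a i else b i) (fun i => if p i then b i else a i) := by
  have h1 := h.left_injective
  have h2 := h.right_injective
  have h3 := h.ne
  refine ⟨?_, ?_, ?_, ?_⟩
  · intro i j hij
    have := h3 i j
    have := h3 j i
    grind [Function.Injective]
  · intro i j hij
    have := h3 i j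
    have := h3 j i
    grind [Function.Injective]
  · intro i j
    have := h3 i j
    have := h3 j i
    grind [Function.Injective]
  · intro i
    have := h.adj i
    have := this.symm
    grind

theorem option (h : G.IsMatchingPair a b) {u v : V} (huv : G.Adj u v)
    (hu : ∀ i, a i ≠ u ∧ b i ≠ u) (hv : ∀ i, a i ≠ v ∧ b i ≠ v) :
    G.IsMatchingPair (fun o : Option ι => o.elim u a) (fun o => o.elim v b) := by
  have hne := huv.ne
  have h1 := h.left_injective
  have h2 := h.right_injective
  refine ⟨?_, ?_, ?_, ?_⟩
  · rintro (_ | i) (_ | j) hij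
    · rfl
    · exact absurd hij.symm (hu j).1
    · exact absurd hij (hu i).1
    · exact congrArg some (h1 hij)
  · rintro (_ | i) (_ | j) hij
    · rfl
    · exact absurd hij.symm (hv j).2
    · exact absurd hij (hv i).2
    · exact congrArg some (h2 hij)
  · rintro (_ | i) (_ | j)
    · exact hne
    · exact (hu j).2.symm
    · exact (hv i).1
    · exact h.ne i j
  · rintro (_ | i)
    · exact huv
    · exact h.adj i

theorem update [DecidableEq ι] (h : G.IsMatchingPair a b) {i : ι} {u : V} (hiu : G.Adj (a i) u)
    (hu : ∀ i, a i ≠ u ∧ b i ≠ u) : G.IsMatchingPair a (Function.update b i u) := by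
  refine ⟨h.left_injective, ?_, ?_, ?_⟩
  · intro j k hjk
    simp only [Function.update_apply] at hjk
    split_ifs at hjk with h1 h2 h2
    · rw [h1, h2]
    · exact absurd hjk.symm (hu k).2
    · exact absurd hjk (hu j).2
    · exact h.right_injective hjk
  · intro j k
    rw [Function.update_apply]
    split_ifs
    · exact (hu j).1
    · exact h.ne j k
  · intro j
    rw [Function.update_apply]
    split_ifs with h1
    · exact h1 ▸ hiu
    · exact h.adj j

variable {t : ℕ} {a b : Fin t → V}

theorem not_adj_of_unmatched (h : G.IsMatchingPair a b) (hG : ¬ G.HasMatching (t + 1)) {u v : V}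
    (hu : ∀ i, a i ≠ u ∧ b i ≠ u) (hv : ∀ i, a i ≠ v ∧ b i ≠ v) : ¬ G.Adj u v := fun huv =>
  hG (by simpa using (h.option huv hu hv).hasMatching)

/-- There is no augmenting path `u, a i, b i, v`. -/
theorem not_adj_right (h : G.IsMatchingPair a b) (hG : ¬ G.HasMatching (t + 1)) {u v : V}
    (hu : ∀ i, a i ≠ u ∧ b i ≠ u) (hv : ∀ i, a i ≠ v ∧ b i ≠ v) (huv : u ≠ v) {i : Fin t}
    (hiu : G.Adj (a i) u) : ¬ G.Adj (b i) v := by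
  refine (h.update hiu hu).not_adj_of_unmatched hG (fun j => ⟨h.ne j i, ?_⟩)
    (fun j => ⟨(hv j).1, ?_⟩)
  · rw [Function.update_apply]
    split_ifs with hj
    · exact (hu i).2.symm
    · exact h.right_injective.ne hj
  · rw [Function.update_apply]
    split_ifs
    · exact huv
    · exact (hv j).2

/-- There is no augmenting path `u, a i, b i, b j, a j, v`. -/
theorem not_adj_right_right (h : G.IsMatchingPair a b) (hG : ¬ G.HasMatching (t + 1)) {u v : V}
    (hu : ∀ i, a i ≠ u ∧ b i ≠ u) (hv : ∀ i, a i ≠ v ∧ b i ≠ v) (huv : u ≠ v) {i j : Fin t}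
    (hij : i ≠ j) (hiu : G.Adj (a i) u) (hjv : G.Adj (a j) v) : ¬ G.Adj (b i) (b j) := by
  intro hb
  refine (h.update hiu hu).not_adj_right hG (u := v) (v := b i) (i := j) (fun k => ⟨(hv k).1, ?_⟩)
    (fun k => ⟨h.ne k i, ?_⟩) (hv i).2.symm hjv ?_
  · rw [Function.update_apply]
    split_ifs
    · exact huv
    · exact (hv k).2
  · rw [Function.update_apply]
    split_ifs with hk
    · exact (hu i).2.symm
    · exact h.right_injective.ne hk
  · rw [Function.update_of_ne hij.symm]
    exact hb.symm

variable [Fintype V] [DecidableEq V] [DecidableRel G.Adj]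

/-- Call `i` heavy if `a i` has two unmatched neighbours. Missing augmenting paths then leave the
heavy `b i` independent and without unmatched neighbours, while both ends of a light pair have at
most one. The degree bound handles the heavy `a i`. -/
theorem card_adj_le_of_oriented (h : G.IsMatchingPair a b)
    (hG : ¬ G.HasMatching (t + 1)) (hdeg : ∀ v, #{w | G.Adj v w} ≤ 2 * t)
    {U : Finset V} (hU : ∀ u, u ∈ U ↔ ∀ i, a i ≠ u ∧ b i ≠ u)
    (hab : ∀ i, #{w ∈ U | G.Adj (b i) w} ≤ #{w ∈ U | G.Adj (a i) w}) :
    #{p : V × V | G.Adj p.1 p.2} ≤ 2 * (t * (2 * t + 1)) := by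
  set d : Finset V → V → ℕ := fun X v => #{w ∈ X | G.Adj v w} with hd
  set e : Finset V → Finset V → ℕ := fun X Y => ∑ v ∈ X, d Y v with he
  have he' : ∀ X Y, e X Y = ∑ v ∈ X, ∑ w ∈ Y, if G.Adj v w then 1 else 0 := fun X Y => by
    simp only [he, hd, card_filter]
  have hcomm : ∀ X Y, e X Y = e Y X := fun X Y => by
    rw [he', he', sum_comm]
    simp only [G.adj_comm]
  have hleft : ∀ X X' Y, e (X ∪ X') Y ≤ e X Y + e X' Y := fun X X' Y => by
    simp only [he]
    rw [← sum_union_inter]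
    exact Nat.le_add_right _ _
  have hright : ∀ X Y Y', e X (Y ∪ Y') ≤ e X Y + e X Y' := fun X Y Y' => by
    rw [hcomm X, hcomm X, hcomm X]
    exact hleft _ _ _
  set H : Finset (Fin t) := {i | 2 ≤ d U (a i)} with hH
  have hindep : ∀ u ∈ U, ∀ v ∈ U, ¬ G.Adj u v := fun u hu v hv =>
    h.not_adj_of_unmatched hG ((hU u).1 hu) ((hU v).1 hv)
  have hheavy : ∀ i ∈ H, ∀ u, ∃ w ∈ U, w ≠ u ∧ G.Adj (a i) w := fun i hi u => by
    obtain ⟨w, hw, hwu⟩ := exists_mem_ne (mem_filter.1 hi).2 u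
    exact ⟨w, (mem_filter.1 hw).1, hwu, (mem_filter.1 hw).2⟩
  have hb0 : ∀ i ∈ H, d U (b i) = 0 := fun i hi => by
    refine card_eq_zero.2 (filter_eq_empty_iff.2 fun u hu => ?_)
    obtain ⟨w, hw, hwu, hadj⟩ := hheavy i hi u
    exact h.not_adj_right hG ((hU w).1 hw) ((hU u).1 hu) hwu hadj
  have hbb : ∀ i ∈ H, ∀ j ∈ H, ¬ G.Adj (b i) (b j) := fun i hi j hj hadj => by
    obtain ⟨v, hv, -, hjv⟩ := hheavy j hj (a i)
    obtain ⟨u, hu, huv, hiu⟩ := hheavy i hi v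
    exact h.not_adj_right_right hG ((hU u).1 hu) ((hU v).1 hv) huv
      (fun hij => hadj.ne (by rw [hij])) hiu hjv hadj
  set B := H.image b with hB
  set W := Hᶜ.image b ∪ Hᶜ.image a with hW
  have hcard : #H + #Hᶜ = t := by simp [card_add_card_compl]
  have hBcard : #B = #H := card_image_of_injective _ h.right_injective
  have hWcard : #W ≤ 2 * #Hᶜ := by
    refine (card_union_le _ _).trans ?_
    have h1 : #(Hᶜ.image b) ≤ #Hᶜ := card_image_le
    have h2 : #(Hᶜ.image a) ≤ #Hᶜ := card_image_le
    omega
  have hcover : (univ : Finset V) = H.image a ∪ ((B ∪ W) ∪ U) := by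
    symm
    refine eq_univ_iff_forall.2 fun v => ?_
    simp only [mem_union, mem_image, hB, hW, hU, mem_compl]
    by_cases hv : ∀ i, a i ≠ v ∧ b i ≠ v
    · exact Or.inr (Or.inr hv)
    · push Not at hv
      obtain ⟨i, hi⟩ := hv
      by_cases h1 : a i = v
      · by_cases h2 : i ∈ H <;> grind
      · by_cases h2 : i ∈ H <;> grind
  have dBW : ∀ v ∈ B ∪ W, d (B ∪ W) v + 1 ≤ #H + 2 * #Hᶜ := fun v hv => by
    have h1 : d (B ∪ W) v < #(B ∪ W) := by
      refine card_lt_card (filter_ssubset.2 ⟨v, hv, G.loopless.irrefl v⟩)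
    have := card_union_le B W
    omega
  have dB : ∀ i ∈ H, d (B ∪ W) (b i) ≤ 2 * #Hᶜ := fun i hi => by
    refine (card_le_card fun w hw => ?_).trans hWcard
    obtain ⟨hw, hadj⟩ := mem_filter.1 hw
    refine (mem_union.1 hw).resolve_left fun hwB => ?_
    obtain ⟨j, hj, rfl⟩ := mem_image.1 hwB
    exact hbb i hi j hj hadj
  have hA : e (H.image a) univ ≤ #H * (2 * t) := by
    rw [← card_image_of_injective H h.left_injective]
    exact sum_le_card_nsmul _ _ _ fun v _ => hdeg v
  have hX : e (B ∪ W) (B ∪ W) + 2 * e (B ∪ W) U ≤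
      #H * (2 * #Hᶜ) + (2 * #Hᶜ) * (#H + 2 * #Hᶜ + 1) := by
    have heq : e (B ∪ W) (B ∪ W) + 2 * e (B ∪ W) U =
        ∑ v ∈ B ∪ W, (d (B ∪ W) v + 2 * d U v) := by
      rw [sum_add_distrib, mul_sum]
    have hle : ∑ v ∈ B ∪ W, (d (B ∪ W) v + 2 * d U v) ≤
        ∑ v ∈ B, (d (B ∪ W) v + 2 * d U v) + ∑ v ∈ W, (d (B ∪ W) v + 2 * d U v) := by
      rw [← sum_union_inter]
      exact Nat.le_add_right _ _
    rw [heq]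
    refine hle.trans (add_le_add ?_ ?_)
    · rw [← hBcard]
      refine sum_le_card_nsmul _ _ _ fun v hv => ?_
      obtain ⟨i, hi, rfl⟩ := mem_image.1 hv
      have := dB i hi
      have := hb0 i hi
      omega
    · refine (sum_le_card_nsmul _ _ (#H + 2 * #Hᶜ + 1) fun v hv => ?_).trans
        (Nat.mul_le_mul_right _ hWcard)
      have h1 := dBW v (mem_union_right _ hv)
      have h2 : d U v ≤ 1 := by
        have light : ∀ i ∈ Hᶜ, d U (a i) ≤ 1 := fun i hi => by
          have : ¬ 2 ≤ d U (a i) := fun h2 => mem_compl.1 hi (mem_filter.2 ⟨mem_univ _, h2⟩)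
          omega
        rcases mem_union.1 hv with hv | hv
        · obtain ⟨i, hi, rfl⟩ := mem_image.1 hv
          exact (hab i).trans (light i hi)
        · obtain ⟨i, hi, rfl⟩ := mem_image.1 hv
          exact light i hi
      omega
  have hUU : e U U = 0 := sum_eq_zero fun u hu =>
    card_eq_zero.2 (filter_eq_empty_iff.2 fun v hv => hindep u hu v hv)
  have htotal : #{p : V × V | G.Adj p.1 p.2} = e univ univ := by
    rw [he', card_filter, ← univ_product_univ, sum_product]
  have hsplit : e univ univ ≤ 2 * e (H.image a) univ + e ((B ∪ W) ∪ U) ((B ∪ W) ∪ U) := by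
    have h1 : e univ univ ≤ e (H.image a) univ + e ((B ∪ W) ∪ U) univ := by
      conv_lhs => arg 1; rw [hcover]
      exact hleft _ _ _
    have h2 : e ((B ∪ W) ∪ U) univ ≤
        e (H.image a) univ + e ((B ∪ W) ∪ U) ((B ∪ W) ∪ U) := by
      conv_lhs => rw [hcover]
      refine (hright _ _ _).trans (Nat.add_le_add_right ?_ _)
      rw [hcomm]
      exact sum_le_sum fun v _ => card_le_card (filter_subset_filter _ (subset_univ _))
    omega
  have hsplit' : e ((B ∪ W) ∪ U) ((B ∪ W) ∪ U) ≤ e (B ∪ W) (B ∪ W) + 2 * e (B ∪ W) U := by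
    have h1 := hleft (B ∪ W) U ((B ∪ W) ∪ U)
    have h2 := hright (B ∪ W) (B ∪ W) U
    have h3 := hright U (B ∪ W) U
    have h4 := hcomm U (B ∪ W)
    omega
  rw [htotal]
  have hfin := hsplit.trans (Nat.add_le_add (Nat.mul_le_mul_left 2 hA) (hsplit'.trans hX))
  refine hfin.trans ?_
  -- With `k` heavy and `l` light pairs the bound reached is `4 * (k + l) ^ 2 + 2 * l`, and `t = k +
  -- l`.
  generalize #H = k at hcard ⊢
  generalize #Hᶜ = l at hcard ⊢
  subst hcard
  nlinarith

theorem card_adj_le (h : G.IsMatchingPair a b)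
    (hG : ¬ G.HasMatching (t + 1)) (hdeg : ∀ v, #{w | G.Adj v w} ≤ 2 * t) :
    #{p : V × V | G.Adj p.1 p.2} ≤ 2 * (t * (2 * t + 1)) := by
  set U : Finset V := {u | ∀ i, a i ≠ u ∧ b i ≠ u}
  refine (h.swap fun i => #{w ∈ U | G.Adj (b i) w} ≤ #{w ∈ U | G.Adj (a i) w}).card_adj_le_of_oriented
    hG hdeg (U := U) (fun u => ?_) (fun i => ?_)
  · simp only [U, mem_filter_univ]
    refine forall_congr' fun i => ?_
    split_ifs
    · rfl
    · exact and_comm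
  · split_ifs with hi
    · exact hi
    · exact (not_le.1 hi).le

end IsMatchingPair

/-- A matching of `G'` misses `v` and covers only `2 * t` vertices, so some edge of `G` from `v` to
a free neighbour would extend it. -/
theorem not_hasMatching_of_degree_lt {V : Type*} [Fintype V] [DecidableEq V]
    {G G' : SimpleGraph V} [DecidableRel G.Adj] {t : ℕ} {v : V} (hG : ¬ G.HasMatching (t + 1))
    (hle : G' ≤ G) (hv : ∀ u, ¬ G'.Adj u v) (hdeg : 2 * t < #{w | G.Adj v w}) :
    ¬ G'.HasMatching t := by
  rintro ⟨a, b, h⟩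
  have hcard : #(univ.image a ∪ univ.image b) < #{w | G.Adj v w} := by
    refine (card_union_le _ _).trans_lt ?_
    have h1 : #(univ.image a) ≤ #(univ : Finset (Fin t)) := card_image_le
    have h2 : #(univ.image b) ≤ #(univ : Finset (Fin t)) := card_image_le
    rw [card_univ, Fintype.card_fin] at h1 h2
    omega
  obtain ⟨w, hw, hw'⟩ := exists_mem_notMem_of_card_lt_card hcard
  have h' : G.IsMatchingPair a b := ⟨h.1, h.2, h.3, fun i => hle (h.4 i)⟩
  refine h'.not_adj_of_unmatched hG (fun i => ⟨?_, ?_⟩) (fun i => ?_) (mem_filter.1 hw).2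
  · rintro rfl
    exact hv _ (h.adj i).symm
  · rintro rfl
    exact hv _ (h.adj i)
  · simp only [mem_union, mem_image, mem_univ, true_and, not_or, not_exists] at hw'
    exact ⟨hw'.1 i, hw'.2 i⟩

/-- A graph with no matching of size `t + 1` has a set `A` of at most `t` vertices such that the
number of edges avoiding `A` is at most that of a complete graph on `2 (t - |A|) + 1` vertices. -/
theorem exists_card_adj_avoiding_le {V : Type*} [Fintype V] [DecidableEq V] (t : ℕ)
    (G : SimpleGraph V) [DecidableRel G.Adj] (hG : ¬ G.HasMatching (t + 1)) :
    ∃ A : Finset V, #A ≤ t ∧ #{p : V × V | G.Adj p.1 p.2 ∧ p.1 ∉ A ∧ p.2 ∉ A} ≤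
      2 * ((t - #A) * (2 * (t - #A) + 1)) := by
  classical
  induction t generalizing G with
  | zero =>
    refine ⟨∅, le_rfl, ?_⟩
    have : ∀ u v, ¬ G.Adj u v := fun u v =>
      (⟨fun i => i.elim0, fun i => i.elim0, fun i => i.elim0, fun i => i.elim0⟩ :
        G.IsMatchingPair (Fin.elim0 : Fin 0 → V) Fin.elim0).not_adj_of_unmatched hG
        (fun i => i.elim0) (fun i => i.elim0)
    simp [this]
  | succ t ih =>
    -- A vertex of larger degree goes into `A`, and its removal lowers the matching bound by one.
    -- Without such a vertex `A = ∅` works as soon as the bound `t + 1` is attained.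
    by_cases hdeg : ∀ v, #{w | G.Adj v w} ≤ 2 * (t + 1)
    · by_cases hM : G.HasMatching (t + 1)
      · obtain ⟨a, b, h⟩ := hM
        exact ⟨∅, Nat.zero_le _, by simpa using h.card_adj_le hG hdeg⟩
      · obtain ⟨A, hA, hle⟩ := ih G hM
        refine ⟨A, by omega, hle.trans ?_⟩
        gcongr <;> omega
    · push Not at hdeg
      obtain ⟨v, hv⟩ := hdeg
      let G' : SimpleGraph V :=
        { Adj := fun u w => G.Adj u w ∧ u ≠ v ∧ w ≠ v
          symm := ⟨fun _ _ h => ⟨h.1.symm, h.2.2, h.2.1⟩⟩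
          loopless := ⟨fun _ h => h.1.ne rfl⟩ }
      obtain ⟨A, hA, hle⟩ := ih G' (not_hasMatching_of_degree_lt hG (fun _ _ h => h.1)
        (fun u h => h.2.2 rfl) hv)
      have hcard := card_insert_le v A
      refine ⟨insert v A, by omega, (card_le_card fun p hp => ?_).trans (hle.trans ?_)⟩
      · simp only [mem_filter_univ, mem_insert, not_or] at hp ⊢
        exact ⟨⟨hp.1, hp.2.1.1, hp.2.2.1⟩, hp.2.1.2, hp.2.2.2⟩
      · have hsub : t - #A ≤ t + 1 - #(insert v A) := by omega
        gcongr

end SimpleGraph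

/-! ### Clique-cones: clique counts, a good colouring, and the comparison. -/

namespace SimpleGraph

open Finset

theorem IsMatchingPair.sum_add_le {V ι : Type*} [Fintype V] [DecidableEq V] [Fintype ι]
    {G : SimpleGraph V} {a b : ι → V} (h : G.IsMatchingPair a b) (ω : V → ℕ) :
    ∑ i, (ω (a i) + ω (b i)) ≤ ∑ v, ω v := by
  have hdisj : Disjoint (univ.image a) (univ.image b) := by
    rw [Finset.disjoint_left]
    intro v ha hb
    obtain ⟨i, -, rfl⟩ := mem_image.1 ha
    obtain ⟨j, -, hj⟩ := mem_image.1 hb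
    exact h.ne i j hj.symm
  calc ∑ i, (ω (a i) + ω (b i)) = ∑ v ∈ univ.image a ∪ univ.image b, ω v := by
        rw [sum_union hdisj, sum_image (fun i _ j _ hij => h.left_injective hij),
          sum_image (fun i _ j _ hij => h.right_injective hij), sum_add_distrib]
    _ ≤ ∑ v, ω v := sum_le_sum_of_subset (subset_univ _)

section CliqueCount

variable {V : Type*} [Fintype V] [DecidableEq V]

/-- The contribution to the number of `ℓ`-cliques of those with `z` prescribed vertices in a cone
set, when there are `N` vertices outside the cone set, `m` of which form a clique and the others
of which are isolated. -/
def coneCliqueBound (N m ℓ z : ℕ) : ℕ :=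
  if z ≤ ℓ then (if ℓ - z ≤ 1 then N.choose (ℓ - z) else m.choose (ℓ - z)) else 0

theorem card_cliqueFinset_eq_sum (G : SimpleGraph V) [DecidableRel G.Adj] (Y : Finset V) (ℓ : ℕ) :
    #(G.cliqueFinset ℓ) = ∑ Z ∈ Y.powerset, #{Q ∈ G.cliqueFinset ℓ | Q ∩ Y = Z} :=
  card_eq_sum_card_fiberwise fun _ _ => mem_coe.2 (mem_powerset.2 inter_subset_right)

/-- A clique with trace `Z` on `Y` is determined by its part outside `Y`. Kruskal–Katona bounds
these parts from size 2 on; for sizes 0 and 1 edges carry no information and all subsets are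
counted. -/
theorem card_cliqueFinset_le_sum {n m : ℕ} (G : SimpleGraph (Fin n)) [DecidableRel G.Adj]
    (Y : Finset (Fin n)) (ℓ : ℕ)
    (hm : #{p : Fin n × Fin n | G.Adj p.1 p.2 ∧ p.1 ∉ Y ∧ p.2 ∉ Y} ≤ 2 * m.choose 2) :
    #(G.cliqueFinset ℓ) ≤ ∑ Z ∈ Y.powerset, coneCliqueBound (n - #Y) m ℓ #Z := by
  rw [card_cliqueFinset_eq_sum G Y]
  refine sum_le_sum fun Z hZ => ?_
  have hfiber : ∀ Q ∈ ({Q ∈ G.cliqueFinset ℓ | Q ∩ Y = Z} : Finset (Finset (Fin n))),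
      G.IsClique (Q : Set (Fin n)) ∧ #(Q \ Y) + #Z = ℓ ∧ Q ∩ Y = Z := fun Q hQ => by
    obtain ⟨hQ, hQZ⟩ := mem_filter.1 hQ
    obtain ⟨hQ, hcard⟩ := mem_cliqueFinset_iff.1 hQ
    exact ⟨hQ, by rw [← hQZ, card_sdiff_add_card_inter, hcard], hQZ⟩
  have hinj : Set.InjOn (fun Q : Finset (Fin n) => Q \ Y)
      ({Q ∈ G.cliqueFinset ℓ | Q ∩ Y = Z} : Finset (Finset (Fin n))) := fun Q hQ R hR h => by
    have hQ := (hfiber Q hQ).2.2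
    have hR := (hfiber R hR).2.2
    rw [← sdiff_union_inter Q Y, ← sdiff_union_inter R Y, hQ, hR]
    exact congrArg (· ∪ Z) h
  unfold coneCliqueBound
  split_ifs with h1 h2
  · have hcompl : #Yᶜ = n - #Y := by rw [card_compl, Fintype.card_fin]
    rw [← hcompl, ← card_powersetCard]
    refine card_le_card_of_injOn _ (fun Q hQ => ?_) hinj
    obtain ⟨-, hcard, -⟩ := hfiber Q hQ
    refine mem_coe.2 (mem_powersetCard.2 ⟨fun v hv => ?_, by omega⟩)
    exact mem_compl.2 (mem_sdiff.1 hv).2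
  · let F : SimpleGraph (Fin n) :=
      { Adj := fun u w => G.Adj u w ∧ u ∉ Y ∧ w ∉ Y
        symm := ⟨fun _ _ h => ⟨h.1.symm, h.2.2, h.2.1⟩⟩
        loopless := ⟨fun _ h => h.1.ne rfl⟩ }
    have : DecidableRel F.Adj := fun u w =>
      inferInstanceAs (Decidable (G.Adj u w ∧ u ∉ Y ∧ w ∉ Y))
    have hF : #(F.cliqueFinset 2) ≤ m.choose 2 :=
      Nat.le_of_mul_le_mul_left (F.two_mul_card_cliqueFinset_two_le.trans
        (le_of_eq_of_le (by congr!) hm)) two_pos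
    refine le_trans ?_ (F.card_cliqueFinset_le_choose hF (by omega))
    refine card_le_card_of_injOn _ (fun Q hQ => ?_) hinj
    obtain ⟨hQ, hcard, -⟩ := hfiber Q hQ
    refine mem_coe.2 (mem_cliqueFinset_iff.2 ⟨fun u hu v hv huv => ?_, by omega⟩)
    have hu := mem_sdiff.1 (mem_coe.1 hu)
    have hv := mem_sdiff.1 (mem_coe.1 hv)
    exact ⟨hQ hu.1 hv.1 huv, hu.2, hv.2⟩
  · rw [Nat.le_zero, card_eq_zero]
    refine eq_empty_of_forall_notMem fun Q hQ => ?_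
    have := (hfiber Q hQ).2.1
    omega

theorem sum_le_card_cliqueFinset (G : SimpleGraph V) [DecidableRel G.Adj] {Y M : Finset V} (ℓ : ℕ)
    (hY : ∀ y ∈ Y, ∀ v, v ≠ y → G.Adj y v) (hM : G.IsClique (M : Set V)) (hYM : Disjoint M Y) :
    ∑ Z ∈ Y.powerset, coneCliqueBound (Fintype.card V - #Y) #M ℓ #Z ≤ #(G.cliqueFinset ℓ) := by
  rw [card_cliqueFinset_eq_sum G Y]
  refine sum_le_sum fun Z hZ => ?_
  have hZY := mem_powerset.1 hZ
  have key : ∀ 𝒯 : Finset (Finset V), #Z ≤ ℓ →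
      (∀ T ∈ 𝒯, Disjoint T Y ∧ #T = ℓ - #Z ∧ G.IsClique (T : Set V)) →
      #𝒯 ≤ #{Q ∈ G.cliqueFinset ℓ | Q ∩ Y = Z} := by
    intro 𝒯 hZℓ h𝒯
    refine card_le_card_of_injOn (fun T => T ∪ Z) (fun T hT => ?_) (fun T hT T' hT' h => ?_)
    · obtain ⟨hTY, hcard, hT⟩ := h𝒯 T hT
      refine mem_coe.2 (mem_filter.2 ⟨mem_cliqueFinset_iff.2 ⟨fun u hu v hv huv => ?_, ?_⟩, ?_⟩)
      · rcases mem_union.1 (mem_coe.1 hu) with hu | hu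
        · rcases mem_union.1 (mem_coe.1 hv) with hv | hv
          · exact hT hu hv huv
          · exact (hY v (hZY hv) u huv).symm
        · exact hY u (hZY hu) v huv.symm
      · rw [card_union_of_disjoint (disjoint_of_subset_right hZY hTY), hcard]
        omega
      · rw [union_inter_distrib_right, disjoint_iff_inter_eq_empty.1 hTY, empty_union,
          inter_eq_left.2 hZY]
    · have hT := disjoint_of_subset_right hZY (h𝒯 T hT).1
      have hT' := disjoint_of_subset_right hZY (h𝒯 T' hT').1
      have h : (T ∪ Z) \ Z = (T' ∪ Z) \ Z := congrArg (· \ Z) h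
      rwa [union_sdiff_cancel_right hT, union_sdiff_cancel_right hT'] at h
  unfold coneCliqueBound
  split_ifs with h1 h2
  · rw [← card_compl, ← card_powersetCard]
    refine key _ h1 fun T hT => ?_
    obtain ⟨hTY, hcard⟩ := mem_powersetCard.1 hT
    refine ⟨Finset.disjoint_left.2 fun v hv => mem_compl.1 (hTY hv), hcard, ?_⟩
    exact Set.Subsingleton.pairwise (card_le_one_iff_subsingleton.1 (by omega)) _
  · rw [← card_powersetCard]
    refine key _ h1 fun T hT => ?_
    obtain ⟨hTM, hcard⟩ := mem_powersetCard.1 hT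
    exact ⟨disjoint_of_subset_left hTM hYM, hcard, hM.subset (coe_subset.2 hTM)⟩
  · exact Nat.zero_le _

end CliqueCount

theorem _root_.Finset.exists_coloring_card_le {α ι : Type*} [DecidableEq α] [Fintype ι]
    [DecidableEq ι] [Nonempty ι] (r : ι → ℕ) (Y : Finset α) (h : #Y ≤ ∑ j, r j) :
    ∃ c : α → ι, ∀ j, #{v ∈ Y | c v = j} ≤ r j := by
  induction Y using Finset.induction_on with
  | empty => exact ⟨fun _ => Classical.arbitrary ι, by simp⟩
  | insert v Y hv ih =>
    rw [card_insert_of_notMem hv] at h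
    obtain ⟨c, hc⟩ := ih (by omega)
    have hsum : ∑ j, #{v ∈ Y | c v = j} < ∑ j, r j := by
      rw [← card_eq_sum_card_fiberwise (fun _ _ => mem_coe.2 (mem_univ _))]
      omega
    obtain ⟨j, -, hj⟩ := exists_lt_of_sum_lt hsum
    have hY : ∀ i, ({w ∈ Y | Function.update c v j w = i} : Finset α) = {w ∈ Y | c w = i} :=
      fun i => filter_congr fun w hw => by
        rw [Function.update_of_ne (ne_of_mem_of_not_mem hw hv)]
    refine ⟨Function.update c v j, fun i => ?_⟩
    rw [filter_insert, Function.update_self, hY]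
    split_ifs with hij
    · subst hij
      exact (card_insert_le _ _).trans hj
    · exact hc i

theorem _root_.Fin.card_filter_le_lt {n a b : ℕ} (hb : b ≤ n) :
    #{v : Fin n | a ≤ (v : ℕ) ∧ (v : ℕ) < b} = b - a := by
  rw [← Nat.card_Ico, ← card_map Fin.valEmbedding]
  congr 1
  ext i
  simp only [mem_map, mem_filter_univ, Fin.valEmbedding_apply, mem_Ico]
  exact ⟨fun ⟨v, hv, hi⟩ => hi ▸ hv, fun hi => ⟨⟨i, by omega⟩, hi, rfl⟩⟩

/-- The clique gets colour `j₀` and uses up `s` of its `t j₀ - 1` allowed matching edges; what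
remains of all the allowances is shared among the cone vertices. -/
theorem not_arrows_cliqueCone {n x y s q : ℕ} (hxy : x + y ≤ n) {t : Fin q → ℕ} {j₀ : Fin q}
    (ht : ∀ j, 0 < t j) (hx : x ≤ 2 * s + 1) (hs : s + 1 ≤ t j₀)
    (hy : y + s ≤ ∑ j, (t j - 1)) :
    ¬ Arrows (cliqueCone n x y) (matchingGraphs t) := by
  classical
  have : Nonempty (Fin q) := ⟨j₀⟩
  set r : Fin q → ℕ := Function.update (fun j => t j - 1) j₀ (t j₀ - 1 - s) with hr
  have hr₀ : r j₀ = t j₀ - 1 - s := Function.update_self _ _ _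
  have hr₁ : ∀ j, j ≠ j₀ → r j = t j - 1 := fun j hj => Function.update_of_ne hj _ _
  set Y : Finset (Fin n) := {v | x ≤ (v : ℕ) ∧ (v : ℕ) < x + y} with hY
  have hYcard : #Y ≤ ∑ j, r j := by
    have h1 : ∑ j, (t j - 1) = (t j₀ - 1) + ∑ j ∈ univ.erase j₀, (t j - 1) :=
      (add_sum_erase _ _ (mem_univ _)).symm
    have h2 : ∑ j, r j = r j₀ + ∑ j ∈ univ.erase j₀, r j :=
      (add_sum_erase _ _ (mem_univ _)).symm
    rw [sum_congr rfl fun j hj => hr₁ j (ne_of_mem_erase hj), hr₀] at h2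
    rw [hY, Fin.card_filter_le_lt hxy]
    omega
  obtain ⟨c, hc⟩ := exists_coloring_card_le r Y hYcard
  intro hA
  obtain ⟨j, hj⟩ := hA fun e => if h : ∃ v ∈ e.1, v ∈ Y then c h.choose else j₀
  obtain ⟨a, b, h⟩ := matchingGraph_isContained_iff.1 hj
  -- A doubled fractional vertex cover of colour `j`: cone vertices of that colour weigh 2, clique
  -- vertices weigh 1 when `j = j₀`. Its total is below `2 * t j`, as `2 * (t j₀ - 1 - s) + (2 * s +
  -- 1) < 2 * t j₀`.
  set ω : Fin n → ℕ := fun v =>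
    2 * (if v ∈ Y ∧ c v = j then 1 else 0) + (if (v : ℕ) < x ∧ j = j₀ then 1 else 0) with hω
  have hedge : ∀ i, 2 ≤ ω (a i) + ω (b i) := by
    intro i
    obtain ⟨hadj, hcol⟩ := (EdgeLabeling.labelGraph_adj _ _).1 (h.adj i)
    split_ifs at hcol with hex
    · obtain ⟨hmem, hwY⟩ := hex.choose_spec
      have hw : 2 ≤ ω hex.choose := by
        simp only [hω, if_pos (And.intro hwY hcol)]
        omega
      rcases Sym2.mem_iff.1 hmem with hw' | hw' <;> rw [hw'] at hw <;> omega
    · have hnot : ∀ v ∈ s(a i, b i), v ∉ Y := fun v hv hvY => hex ⟨v, hv, hvY⟩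
      have ha := hnot (a i) (by simp)
      have hb := hnot (b i) (by simp)
      simp only [hY, mem_filter_univ] at ha hb
      have hlt : (a i : ℕ) < x ∧ (b i : ℕ) < x := by
        rcases hadj.2 with h | h | h
        · exact h
        · exact absurd h ha
        · exact absurd h hb
      simp only [hω, if_pos (And.intro hlt.1 hcol.symm), if_pos (And.intro hlt.2 hcol.symm)]
      omega
  have hlow : 2 * t j ≤ ∑ i, (ω (a i) + ω (b i)) := by
    have := card_nsmul_le_sum (univ : Finset (Fin (t j))) _ 2 fun i _ => hedge i
    simpa [mul_comm] using this
  have hup : ∑ v, ω v = 2 * #{v ∈ Y | c v = j} + #{v : Fin n | (v : ℕ) < x ∧ j = j₀} := by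
    simp only [hω]
    rw [sum_add_distrib, ← mul_sum, ← card_filter, ← card_filter]
    congr 3
    ext v
    simp
  have hle := hlow.trans (h.sum_add_le ω)
  rw [hup] at hle
  have hcj := hc j
  have htj := ht j
  by_cases hjj : j = j₀
  · subst hjj
    have hxcard : #{v : Fin n | (v : ℕ) < x ∧ j = j} = x := by
      have := Fin.card_filter_le_lt (n := n) (a := 0) (b := x) (by omega)
      simpa using this
    omega
  · have hxcard : #{v : Fin n | (v : ℕ) < x ∧ j = j₀} = 0 := by
      simp [hjj]
    have := hr₁ j hjj
    omega

/-- Only `k` cone vertices are treated as such; the others join the clique set. `Y` enters through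
its size alone, so it may come from another graph. -/
theorem sum_le_card_cliqueFinset_cliqueCone {n x y k ℓ : ℕ} (hxy : x + y ≤ n) (hk : k ≤ y)
    [DecidableRel (cliqueCone n x y).Adj] {Y : Finset (Fin n)} (hY : #Y = k) :
    ∑ Z ∈ Y.powerset, coneCliqueBound (n - #Y) (x + y - k) ℓ #Z ≤
      #((cliqueCone n x y).cliqueFinset ℓ) := by
  set Y' : Finset (Fin n) := {v | x ≤ (v : ℕ) ∧ (v : ℕ) < x + k} with hY'
  set M : Finset (Fin n) := ({v | 0 ≤ (v : ℕ) ∧ (v : ℕ) < x + y} : Finset (Fin n)) \ Y' with hM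
  have hY'card : #Y' = k := by
    rw [hY', Fin.card_filter_le_lt (by omega)]
    omega
  have hMcard : #M = x + y - k := by
    rw [hM, card_sdiff_of_subset, Fin.card_filter_le_lt hxy, hY'card]
    · rfl
    · intro v hv
      simp only [hY', mem_filter_univ] at hv ⊢
      omega
  have h := sum_le_card_cliqueFinset (cliqueCone n x y) (Y := Y') (M := M) ℓ
    (fun u hu v huv => ?_) (fun u hu v hv huv => ?_) sdiff_disjoint
  · rw [Fintype.card_fin, hY'card, hMcard, sum_powerset_apply_card, hY'card] at h
    rw [sum_powerset_apply_card, hY]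
    exact h
  · simp only [hY', mem_filter_univ] at hu
    exact ⟨huv.symm, Or.inr (Or.inl (by omega))⟩
  · simp only [hM, hY', mem_coe, mem_sdiff, mem_filter_univ] at hu hv
    refine ⟨huv, ?_⟩
    omega

/-- Any graph that does not arrow `(t₁ K₂, …, t_q K₂)` has at most as many `ℓ`-cliques as some
clique-cone with the same property. -/
theorem exists_cliqueCone_cliqueCount_le {n ℓ q : ℕ} (hn : 1 ≤ n) (hq : 1 ≤ q)
    {t : Fin q → ℕ} (ht : ∀ j, 0 < t j) (G : SimpleGraph (Fin n))
    (hG : ¬ Arrows G (matchingGraphs t)) :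
    ∃ x y : ℕ, 1 ≤ x ∧ x ≤ 2 * univ.sup t - 1 ∧ x + y ≤ n ∧
      ¬ Arrows (cliqueCone n x y) (matchingGraphs t) ∧
      cliqueCount ℓ G ≤ cliqueCount ℓ (cliqueCone n x y) := by
  classical
  simp only [Arrows, not_forall, not_exists] at hG
  obtain ⟨C, hC⟩ := hG
  have hcover : ∀ j, ∃ A : Finset (Fin n), #A ≤ t j - 1 ∧
      #{p : Fin n × Fin n | (C.labelGraph j).Adj p.1 p.2 ∧ p.1 ∉ A ∧ p.2 ∉ A} ≤
        2 * ((t j - 1 - #A) * (2 * (t j - 1 - #A) + 1)) := fun j => by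
    refine exists_card_adj_avoiding_le (t j - 1) (C.labelGraph j) ?_
    rw [Nat.sub_add_cancel (ht j), ← matchingGraph_isContained_iff]
    exact hC j
  choose A hA hAe using hcover
  set d : Fin q → ℕ := fun j => t j - 1 - #(A j) with hd
  have : Nonempty (Fin q) := ⟨⟨0, hq⟩⟩
  obtain ⟨j₀, hj₀⟩ := Finite.exists_max d
  set s := d j₀ with hs
  set S := ∑ j, (t j - 1) with hS
  set Y := univ.biUnion A with hY
  have hYcard : #Y ≤ ∑ j, #(A j) := card_biUnion_le
  have hSd : S = ∑ j, #(A j) + ∑ j, d j := by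
    rw [← sum_add_distrib]
    exact sum_congr rfl fun j _ => by have := hA j; simp only [hd]; omega
  have hsd : s ≤ ∑ j, d j := single_le_sum (f := d) (fun _ _ => Nat.zero_le _) (mem_univ j₀)
  have hst : s + 1 ≤ t j₀ := by have := ht j₀; simp only [hs, hd]; omega
  have hsup : t j₀ ≤ univ.sup t := le_sup (mem_univ j₀)
  have hedges : #{p : Fin n × Fin n | G.Adj p.1 p.2 ∧ p.1 ∉ Y ∧ p.2 ∉ Y} ≤
      2 * ((∑ j, d j) * (2 * s + 1)) := by
    have hsub : ({p : Fin n × Fin n | G.Adj p.1 p.2 ∧ p.1 ∉ Y ∧ p.2 ∉ Y} : Finset _) ⊆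
        univ.biUnion fun j =>
          {p : Fin n × Fin n | (C.labelGraph j).Adj p.1 p.2 ∧ p.1 ∉ A j ∧ p.2 ∉ A j} := by
      intro p hp
      obtain ⟨hadj, h1, h2⟩ := (mem_filter.1 hp).2
      refine mem_biUnion.2 ⟨C ⟨s(p.1, p.2), hadj⟩, mem_univ _, mem_filter.2 ⟨mem_univ _, ?_, ?_, ?_⟩⟩
      · exact (EdgeLabeling.labelGraph_adj _ _).2 ⟨hadj, rfl⟩
      · exact fun h => h1 (mem_biUnion.2 ⟨_, mem_univ _, h⟩)
      · exact fun h => h2 (mem_biUnion.2 ⟨_, mem_univ _, h⟩)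
    refine (card_le_card hsub).trans (card_biUnion_le.trans ?_)
    rw [sum_mul, mul_sum]
    refine sum_le_sum fun j _ => (hAe j).trans ?_
    have := hj₀ j
    change 2 * (d j * (2 * d j + 1)) ≤ _
    gcongr
  -- If either minimum truncates, then `x + y = n` and the clique-cone is complete, so the
  -- comparison is trivial.
  set x := min (2 * s + 1) n with hx
  set y := min (S - s) (n - x) with hy
  have hxy : x + y ≤ n := by omega
  refine ⟨x, y, by omega, by omega, hxy,
    not_arrows_cliqueCone hxy ht (min_le_left _ _) hst (by omega), ?_⟩
  rw [cliqueCount, cliqueCount, copyCount_completeGraph, copyCount_completeGraph]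
  by_cases hfull : x + y = n
  · refine card_le_card (cliqueFinset_mono _ fun u v huv => ⟨huv.ne, ?_⟩)
    have := u.2
    have := v.2
    omega
  · have hx' : x = 2 * s + 1 := by omega
    have hy' : y = S - s := by omega
    have hkY : #Y ≤ y := by omega
    refine (card_cliqueFinset_le_sum G Y ℓ (hedges.trans ?_)).trans
      (sum_le_card_cliqueFinset_cliqueCone hxy hkY rfl)
    -- The claim becomes `2 * (s + e) * (2 * s + 1) ≤ (2 * s + 1 + e) * (2 * s + e)`, whose two
    -- sides differ by `e * e - e`.
    obtain ⟨e, he⟩ : ∃ e, ∑ j, d j = s + e := ⟨_, (Nat.add_sub_cancel' hsd).symm⟩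
    have hm : 2 * s + 1 + e ≤ x + y - #Y := by omega
    refine le_trans ?_ (Nat.mul_le_mul_left 2 (Nat.choose_le_choose 2 hm))
    rw [he, mul_comm 2 (Nat.choose _ _), Nat.choose_two_right,
      Nat.div_mul_cancel (Nat.even_mul_pred_self _).two_dvd]
    have : 2 * s + 1 + e - 1 = 2 * s + e := by omega
    rw [this]
    have : e ≤ e * e := Nat.le_mul_self e
    nlinarith

theorem not_arrows_bot {n q : ℕ} (hq : 1 ≤ q) {t : Fin q → ℕ} (ht : ∀ j, 0 < t j) :
    ¬ Arrows (⊥ : SimpleGraph (Fin n)) (matchingGraphs t) := fun h => by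
  obtain ⟨j, hj⟩ := h fun _ => ⟨0, hq⟩
  obtain ⟨a, b, h⟩ := matchingGraph_isContained_iff.1 hj
  exact EdgeLabeling.labelGraph_le _ (h.adj ⟨0, ht j⟩)

end SimpleGraph

theorem theorem1 (n ℓ q : ℕ) (hℓ : 2 ≤ ℓ) (hn : ℓ ≤ n) (hq : 1 ≤ q)
    (t : Fin q → ℕ) (ht : ∀ j, 0 < t j) :
    ∃ x y : ℕ, 1 ≤ x ∧ x ≤ 2 * Finset.univ.sup t - 1 ∧ x + y ≤ n ∧
      ¬ Arrows (cliqueCone n x y) (matchingGraphs t) ∧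
      cliqueCount ℓ (cliqueCone n x y) =
        grt (⊤ : SimpleGraph (Fin ℓ)) n (matchingGraphs t) := by
  classical
  set 𝒢 := Finset.univ.filter fun G : SimpleGraph (Fin n) => ¬ Arrows G (matchingGraphs t) with h𝒢
  have hgrt : grt (⊤ : SimpleGraph (Fin ℓ)) n (matchingGraphs t) = 𝒢.sup (cliqueCount ℓ) := by
    unfold grt
    congr!
  have hne : 𝒢.Nonempty :=
    ⟨⊥, Finset.mem_filter.2 ⟨Finset.mem_univ _, SimpleGraph.not_arrows_bot hq ht⟩⟩
  obtain ⟨G, hG, hsup⟩ := Finset.exists_mem_eq_sup 𝒢 hne (cliqueCount ℓ)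
  obtain ⟨x, y, hx1, hx2, hxy, hnot, hle⟩ :=
    SimpleGraph.exists_cliqueCone_cliqueCount_le (ℓ := ℓ) (by omega) hq ht G
      (Finset.mem_filter.1 hG).2
  refine ⟨x, y, hx1, hx2, hxy, hnot, ?_⟩
  rw [hgrt]
  refine le_antisymm ?_ (hsup ▸ hle)
  exact Finset.le_sup (f := cliqueCount ℓ) (Finset.mem_filter.2 ⟨Finset.mem_univ _, hnot⟩)
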